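/- Let $k$ be a field of characteristic $0$ and $\lambda\in k$. All algebras are associative and unital. A derivation of weight $\lambda$ on a $k$-algebra $R$ is a $k$-linear map $d:R\to R$ with $d(1)=0$ and $d(ab)=d(a)b+a\,d(b)+\lambda\, d(a)d(b)$; the pair $(R,d)$ is a differential algebra of weight $\lambda$. For an algebra $A$, the free differential algebra $D_\lambda(A)$ of weight $\lambda$ on $A$ is a differential algebra with an algebra homomorphism $i_A:A\to D_\lambda(A)$ such that every algebra homomorphism from $A$ to a differential algebra of weight $\lambda$ factors uniquely through $i_A$ by a homomorphism of differential algebras; for commutative $A$, $CD_\lambda(A)$ is defined by the same property among commutative differential algebras. Let $X=\{x,y\}$ with $x>y$ and $\Delta(X)=\{z^{(n)}\mid z\in X,\ n\ge 0\}$, ordered by $z^{(m)}\prec t^{(n)}$ iff $m<n$, or $m=n$ and $z<t$. Let $M(Y)$ and $[Y]$ denote the free monoid and the free commutative monoid on a set $Y$. Order $M(\Delta(X))$ by degree (number of letters) and then lexicographically, and order $[\Delta(X)]$ in the same way after writing each commutative word with its letters in decreasing order. Let $d_X$ be the derivation of weight $\lambda$ on $k\langle\Delta(X)\rangle$, respectively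 on $k[\Delta(X)]$, with $d_X(z^{(n)})=z^{(n+1)}$. For $f\neq0$ let $\bar f$ be the leading word of $f$, let $f^\natural$ be $f$ divided by its leading coefficient, and let $|u|$ be the degree of a word $u$. For a set $S$ let $DI(S)$ be the smallest (two-sided) ideal containing $S$ and stable under $d_X$. For a set $S$ of monic polynomials and words $a,b$: * In $k\langle\Delta(X)\rangle$, the compositions of $f,g\in S$ are the elements $d_X^i(f)^\natural a-b\,d_X^j(g)^\natural$ with $w=\overline{d_X^i(f)}\,a=b\,\overline{d_X^j(g)}$ and $|w|<|\bar f|+|\bar g|$, and the elements $d_X^i(f)^\natural-a\,d_X^j(g)^\natural b$ with $w=\overline{d_X^i(f)}=a\,\overline{d_X^j(g)}\,b$. Such an element is trivial if it is a linear combination of elements $a'd_X^n(s)b'$ with $s\in S$ and $a'\,\overline{d_X^n(s)}\,b'\prec w$. Let $\mathrm{DIrr}(S)$ be the set of words not of the form $a\,\overline{d_X^n(s)}\,b$ with $s\in S$, $n\ge0$. * In $k[\Delta(X)]$, the compositions are the elements $d_X^i(f)^\natural a-d_X^j(g)^\natural b$ with $w=\overline{d_X^i(f)}\,a=\overline{d_X^j(g)}\,b$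 and $|w|<|\bar f|+|\bar g|$. Such an element is trivial if it is a linear combination of elements $d_X^n(s)a'$ with $s\in S$ and $\overline{d_X^n(s)}\,a'\prec w$. Let $\mathrm{DIrr}(S)$ be the set of commutative words not of the form $\overline{d_X^n(s)}\,a$ with $s\in S$, $n\ge0$. $S$ is a differential Gröbner–Shirshov basis if all compositions of elements of $S$ are trivial. **Proposition.** Let $A=k[x,y]/(x+y+1)$ and $\hat S=\{x^{(0)}+y^{(0)}+1\}$. For every $\lambda\in k$ (including $\lambda=0$): 1. The quotient $k\langle\Delta(X)\rangle/(x^{(m)}+y^{(m)}+\delta_{m,0}\mid m\ge0)$, with the derivation induced by $d_X$ and the algebra homomorphism from $A$ sending the classes of $x,y$ to those of $x^{(0)},y^{(0)}$, is the free differential algebra $D_\lambda(A)$. The ideal $(x^{(m)}+y^{(m)}+\delta_{m,0}\mid m\ge0)$ equals $DI(\hat S)$, and $\hat S$ is a differential Gröbner–Shirshov basis in $k\langle\Delta(X)\rangle$. Moreover $\mathrm{DIrr}(\hat S)=M(\{y^{(m)}\mid m\ge0\})$, and the classes of these words form a $k$-basis of $D_\lambda(A)$. 2. The quotient $k[\Delta(X)]/(x^{(m)}+y^{(m)}+\delta_{m,0}\mid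 m\ge0)$, with the derivation induced by $d_X$ and the algebra homomorphism from $A$ sending the classes of $x,y$ to those of $x^{(0)},y^{(0)}$, is the free commutative differential algebra $CD_\lambda(A)$. The ideal $(x^{(m)}+y^{(m)}+\delta_{m,0}\mid m\ge0)$ equals $DI(\hat S)$, and $\hat S$ is a differential Gröbner–Shirshov basis in $k[\Delta(X)]$. Moreover $\mathrm{DIrr}(\hat S)=[\{y^{(m)}\mid m\ge0\}]$, and the classes of these commutative words form a $k$-basis of $CD_\lambda(A)$. -/

import Mathlib

universe u v w

noncomputable section

namespace DiffGS

/-! ### Differential algebras of weight `lam` and free objects on an algebra -/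

/-- A linear operator `d` on a unital algebra is a derivation of weight `lam`. -/
structure IsWeightedDerivation {k : Type u} [Field k] {R : Type v} [Ring R] [Algebra k R]
    (lam : k) (d : R →ₗ[k] R) : Prop where
  map_one : d 1 = 0
  leibniz : ∀ a b : R, d (a * b) = d a * b + a * d b + lam • (d a * d b)

/-- `(D, dD)` with the algebra map `i : A → D` is a free differential algebra of weight `lam`
on the algebra `A`. -/
def IsFreeDiffAlgOn {k : Type u} [Field k] {A D : Type u} [Ring A] [Algebra k A]
    [Ring D] [Algebra k D] (lam : k) (dD : D →ₗ[k] D) (i : A →ₐ[k] D) : Prop :=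
  IsWeightedDerivation lam dD ∧
    ∀ (R : Type w) [Ring R] [Algebra k R] (d : R →ₗ[k] R), IsWeightedDerivation lam d →
      ∀ φ : A →ₐ[k] R, ∃! ψ : D →ₐ[k] R, (∀ z, ψ (dD z) = d (ψ z)) ∧ ψ.comp i = φ

/-- `(D, dD)` with the algebra map `i : A → D` is a free commutative differential algebra of
weight `lam` on the commutative algebra `A`. -/
def IsFreeCommDiffAlgOn {k : Type u} [Field k] {A D : Type u} [CommRing A] [Algebra k A]
    [CommRing D] [Algebra k D] (lam : k) (dD : D →ₗ[k] D) (i : A →ₐ[k] D) : Prop :=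
  IsWeightedDerivation lam dD ∧
    ∀ (R : Type w) [CommRing R] [Algebra k R] (d : R →ₗ[k] R), IsWeightedDerivation lam d →
      ∀ φ : A →ₐ[k] R, ∃! ψ : D →ₐ[k] R, (∀ z, ψ (dD z) = d (ψ z)) ∧ ψ.comp i = φ

/-! ### Differential letters -/

/-- The alphabet `Δ(X)`: the letter `x^{(n)}` is the pair `(n, x)`, and the lexicographic order is
`x^{(m)} ≺ y^{(n)}` iff `m < n`, or `m = n` and `x < y`. -/
abbrev Letter (X : Type*) : Type _ := ℕ ×ₗ X

/-- The letter `x^{(n)}`. -/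
def letter {X : Type*} (x : X) (n : ℕ) : Letter X := toLex (n, x)

/-- The letter `x^{(n+1)}` following `x^{(n)}`. -/
def Letter.next {X : Type*} (c : Letter X) : Letter X := toLex ((ofLex c).1 + 1, (ofLex c).2)

/-! ### The noncommutative setting -/

namespace NC

/-- The free monoid `M(Δ(X))`. -/
abbrev Word (X : Type*) : Type _ := FreeMonoid (Letter X)

/-- The noncommutative polynomial algebra `k⟨Δ(X)⟩`, with linear basis the words. -/
abbrev Poly (k : Type*) [Field k] (X : Type*) : Type _ := MonoidAlgebra k (Word X)

/-- The word `p` as an element of `k⟨Δ(X)⟩`. -/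
def mono (k : Type*) [Field k] {X : Type*} (p : Word X) : Poly k X := MonoidAlgebra.of k _ p

/-- The letter `c` as an element of `k⟨Δ(X)⟩`. -/
def var (k : Type*) [Field k] {X : Type*} (c : Letter X) : Poly k X := mono k (FreeMonoid.of c)

/-- The value of the derivation `d_X` on a word. -/
def derivWord {k : Type*} [Field k] {X : Type*} (lam : k) : List (Letter X) → Poly k X
  | [] => 0
  | c :: p => var k c.next * mono k (FreeMonoid.ofList p) + var k c * derivWord lam p
      + lam • (var k c.next * derivWord lam p)

/-- The derivation `d_X` of weight `lam` on `k⟨Δ(X)⟩`. -/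
def deriv {k : Type*} [Field k] {X : Type*} (lam : k) : Poly k X →ₗ[k] Poly k X :=
  (Finsupp.linearCombination k fun p : Word X => derivWord lam (FreeMonoid.toList p)) ∘ₗ
    (MonoidAlgebra.coeffLinearEquiv k).toLinearMap

/-- The differential ideal `DI(U)` generated by `U`. -/
def diffIdeal {k : Type*} [Field k] {X : Type*} (lam : k) (U : Set (Poly k X)) :
    TwoSidedIdeal (Poly k X) :=
  sInf {I | U ⊆ (I : Set (Poly k X)) ∧ ∀ f ∈ I, deriv lam f ∈ I}

/-- The deg-lex order `≺` on words. -/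
def WordLT {X : Type*} [LinearOrder X] (p q : Word X) : Prop :=
  List.Shortlex (· < ·) (FreeMonoid.toList p) (FreeMonoid.toList q)

/-- `p` is the leading word of `f` (in particular `f ≠ 0`). -/
def IsLeading {k : Type*} [Field k] {X : Type*} [LinearOrder X] (f : Poly k X) (p : Word X) :
    Prop :=
  f.coeff p ≠ 0 ∧ ∀ q, f.coeff q ≠ 0 → q = p ∨ WordLT q p

/-- `f` divided by its coefficient at `p`: this is `f^♮` when `p` is the leading word of `f`. -/
def natural {k : Type*} [Field k] {X : Type*} (f : Poly k X) (p : Word X) : Poly k X :=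
  (f.coeff p)⁻¹ • f

/-- `f` is trivial modulo `(S, p)`. The `⋆`-word `a ⋆ b` is recorded by the pair `(a, b)`. -/
def TrivialMod {k : Type*} [Field k] {X : Type*} [LinearOrder X] (lam : k) (S : Set (Poly k X))
    (p : Word X) (f : Poly k X) : Prop :=
  f ∈ Submodule.span k {h : Poly k X | ∃ s ∈ S, ∃ (n : ℕ) (a b l : Word X),
    IsLeading ((deriv lam)^[n] s) l ∧ WordLT (a * l * b) p ∧
      h = mono k a * (deriv lam)^[n] s * mono k b}

/-- `S` is a differential Gröbner-Shirshov basis in `k⟨Δ(X)⟩`: it consists of monic polynomials,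
and all its intersection and inclusion compositions are trivial. -/
structure IsGSBasis {k : Type*} [Field k] {X : Type*} [LinearOrder X] (lam : k)
    (S : Set (Poly k X)) : Prop where
  monic : ∀ f ∈ S, ∃ p, IsLeading f p ∧ f.coeff p = 1
  intersection : ∀ f ∈ S, ∀ g ∈ S, ∀ (p q : Word X), IsLeading f p → IsLeading g q →
    ∀ (i j : ℕ) (pᵢ qⱼ a b : Word X),
      IsLeading ((deriv lam)^[i] f) pᵢ → IsLeading ((deriv lam)^[j] g) qⱼ →
      pᵢ * a = b * qⱼ → (pᵢ * a).length < p.length + q.length →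
      TrivialMod lam S (pᵢ * a)
        (natural ((deriv lam)^[i] f) pᵢ * mono k a - mono k b * natural ((deriv lam)^[j] g) qⱼ)
  inclusion : ∀ f ∈ S, ∀ g ∈ S, ∀ (i j : ℕ) (pᵢ qⱼ a b : Word X),
    IsLeading ((deriv lam)^[i] f) pᵢ → IsLeading ((deriv lam)^[j] g) qⱼ →
    pᵢ = a * qⱼ * b →
    TrivialMod lam S pᵢ
      (natural ((deriv lam)^[i] f) pᵢ - mono k a * natural ((deriv lam)^[j] g) qⱼ * mono k b)

/-- The set `DIrr(S)` of differential `S`-irreducible words. -/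
def DIrr {k : Type*} [Field k] {X : Type*} [LinearOrder X] (lam : k) (S : Set (Poly k X)) :
    Set (Word X) :=
  {p | ¬ ∃ s ∈ S, ∃ (n : ℕ) (l a b : Word X),
    IsLeading ((deriv lam)^[n] s) l ∧ p = a * l * b}

end NC

/-! ### The commutative setting -/

namespace Com

/-- The free commutative monoid `[Δ(X)]`, written additively: a commutative word is recorded by
the multiplicities of its letters. -/
abbrev Word (X : Type*) : Type _ := Letter X →₀ ℕ

/-- The polynomial algebra `k[Δ(X)]`. -/
abbrev Poly (k : Type*) [Field k] (X : Type*) : Type _ := MvPolynomial (Letter X) k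

/-- The commutative word `p` as an element of `k[Δ(X)]`. -/
def mono (k : Type*) [Field k] {X : Type*} (p : Word X) : Poly k X := MvPolynomial.monomial p 1

/-- The letter `c` as an element of `k[Δ(X)]`. -/
def var (k : Type*) [Field k] {X : Type*} (c : Letter X) : Poly k X := MvPolynomial.X c

/-- One step of the recursive definition of `d_X` on commutative words: from `(p, d_X p)` to
`(c p, d_X (c p))`. -/
def derivStep {k : Type*} [Field k] {X : Type*} (lam : k) (c : Letter X)
    (z : Poly k X × Poly k X) : Poly k X × Poly k X :=
  (var k c * z.1, var k c.next * z.1 + var k c * z.2 + lam • (var k c.next * z.2))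

instance {k : Type*} [Field k] {X : Type*} (lam : k) :
    LeftCommutative (derivStep lam : Letter X → _ → Poly k X × Poly k X) where
  left_comm a b z := by
    simp only [derivStep, MvPolynomial.smul_eq_C_mul]
    refine Prod.ext ?_ ?_ <;> dsimp only <;> ring

/-- The value of the derivation `d_X` on a commutative word. -/
def derivWord {k : Type*} [Field k] {X : Type*} (lam : k) (p : Word X) : Poly k X :=
  (Multiset.foldr (derivStep lam) (1, 0) (Finsupp.toMultiset p)).2

/-- The derivation `d_X` of weight `lam` on `k[Δ(X)]`. -/
def deriv {k : Type*} [Field k] {X : Type*} (lam : k) : Poly k X →ₗ[k] Poly k X :=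
  (MvPolynomial.basisMonomials (Letter X) k).constr k (derivWord lam)

/-- The differential ideal `DI(U)` generated by `U`. -/
def diffIdeal {k : Type*} [Field k] {X : Type*} (lam : k) (U : Set (Poly k X)) :
    Ideal (Poly k X) :=
  sInf {I | U ⊆ (I : Set (Poly k X)) ∧ ∀ f ∈ I, deriv lam f ∈ I}

/-- The order `≺` on commutative words: write both words with their letters in decreasing order,
compare first the degrees and then lexicographically. -/
def WordLT {X : Type*} [LinearOrder X] (p q : Word X) : Prop :=
  ∃ l m : List (Letter X), l.Pairwise (· ≥ ·) ∧ m.Pairwise (· ≥ ·) ∧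
    (l : Multiset (Letter X)) = Finsupp.toMultiset p ∧
    (m : Multiset (Letter X)) = Finsupp.toMultiset q ∧ List.Shortlex (· < ·) l m

/-- `p` is the leading word of `f` (in particular `f ≠ 0`). -/
def IsLeading {k : Type*} [Field k] {X : Type*} [LinearOrder X] (f : Poly k X) (p : Word X) :
    Prop :=
  f.coeff p ≠ 0 ∧ ∀ q, f.coeff q ≠ 0 → q = p ∨ WordLT q p

/-- `f` divided by its coefficient at `p`: this is `f^♮` when `p` is the leading word of `f`. -/
def natural {k : Type*} [Field k] {X : Type*} (f : Poly k X) (p : Word X) : Poly k X :=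
  (f.coeff p)⁻¹ • f

/-- `f` is trivial modulo `(S, p)`. -/
def TrivialMod {k : Type*} [Field k] {X : Type*} [LinearOrder X] (lam : k) (S : Set (Poly k X))
    (p : Word X) (f : Poly k X) : Prop :=
  f ∈ Submodule.span k {h : Poly k X | ∃ s ∈ S, ∃ (n : ℕ) (a l : Word X),
    IsLeading ((deriv lam)^[n] s) l ∧ WordLT (l + a) p ∧ h = (deriv lam)^[n] s * mono k a}

/-- `S` is a differential Gröbner-Shirshov basis in `k[Δ(X)]`: it consists of monic polynomials,
and all its compositions are trivial. -/
structure IsGSBasis {k : Type*} [Field k] {X : Type*} [LinearOrder X] (lam : k)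
    (S : Set (Poly k X)) : Prop where
  monic : ∀ f ∈ S, ∃ p, IsLeading f p ∧ f.coeff p = 1
  composition : ∀ f ∈ S, ∀ g ∈ S, ∀ (p q : Word X), IsLeading f p → IsLeading g q →
    ∀ (i j : ℕ) (pᵢ qⱼ a b : Word X),
      IsLeading ((deriv lam)^[i] f) pᵢ → IsLeading ((deriv lam)^[j] g) qⱼ →
      pᵢ + a = qⱼ + b → (pᵢ + a).degree < p.degree + q.degree →
      TrivialMod lam S (pᵢ + a)
        (natural ((deriv lam)^[i] f) pᵢ * mono k a - natural ((deriv lam)^[j] g) qⱼ * mono k b)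

/-- The set `DIrr(S)` of differential `S`-irreducible commutative words. -/
def DIrr {k : Type*} [Field k] {X : Type*} [LinearOrder X] (lam : k) (S : Set (Poly k X)) :
    Set (Word X) :=
  {p | ¬ ∃ s ∈ S, ∃ (n : ℕ) (l a : Word X),
    IsLeading ((deriv lam)^[n] s) l ∧ p = l + a}

end Com

/-! ### The example `A = k[x, y] / (x + y + 1)` with `x > y` -/

/-- The two-element set `{x, y}`; `y` is `0` and `x` is `1`, so that `x > y`. -/
abbrev XY : Type := Fin 2

/-- The generator `x`. -/
def genX : XY := 1

/-- The generator `y`. -/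
def genY : XY := 0

/-- The algebra `A = k[x, y] / (x + y + 1)`. -/
abbrev AlgA (k : Type*) [Field k] : Type _ :=
  MvPolynomial XY k ⧸
    Ideal.span {(MvPolynomial.X genX + MvPolynomial.X genY + 1 : MvPolynomial XY k)}

/-- The class in `A` of a generator. -/
def AlgA.gen (k : Type*) [Field k] (z : XY) : AlgA k := Ideal.Quotient.mk _ (MvPolynomial.X z)

/-- The element `x^{(m)} + y^{(m)} + δ_{m,0}` of `k⟨Δ(X)⟩`. -/
def NC.rel (k : Type*) [Field k] (m : ℕ) : NC.Poly k XY :=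
  NC.var k (letter genX m) + NC.var k (letter genY m) + (if m = 0 then 1 else 0)

/-- The element `x^{(m)} + y^{(m)} + δ_{m,0}` of `k[Δ(X)]`. -/
def Com.rel (k : Type*) [Field k] (m : ℕ) : Com.Poly k XY :=
  Com.var k (letter genX m) + Com.var k (letter genY m) + (if m = 0 then 1 else 0)

/-- The set `{x^{(0)} + y^{(0)} + 1}` in `k⟨Δ(X)⟩`. -/
def NC.sHat (k : Type*) [Field k] : Set (NC.Poly k XY) :=
  {NC.var k (letter genX 0) + NC.var k (letter genY 0) + 1}

/-- The set `{x^{(0)} + y^{(0)} + 1}` in `k[Δ(X)]`. -/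
def Com.sHat (k : Type*) [Field k] : Set (Com.Poly k XY) :=
  {Com.var k (letter genX 0) + Com.var k (letter genY 0) + 1}

/-- The ideal of `k⟨Δ(X)⟩` generated by all `x^{(m)} + y^{(m)} + δ_{m,0}`. -/
def NC.relIdeal (k : Type*) [Field k] : TwoSidedIdeal (NC.Poly k XY) :=
  TwoSidedIdeal.span (Set.range (NC.rel k))

/-- The ideal of `k[Δ(X)]` generated by all `x^{(m)} + y^{(m)} + δ_{m,0}`. -/
def Com.relIdeal (k : Type*) [Field k] : Ideal (Com.Poly k XY) :=
  Ideal.span (Set.range (Com.rel k))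

/-- The quotient `k⟨Δ(X)⟩ / (x^{(m)} + y^{(m)} + δ_{m,0} | m ≥ 0)`. -/
abbrev NC.Quot (k : Type*) [Field k] : Type _ := (NC.relIdeal k).ringCon.Quotient

/-- The quotient `k[Δ(X)] / (x^{(m)} + y^{(m)} + δ_{m,0} | m ≥ 0)`. -/
abbrev Com.Quot (k : Type*) [Field k] : Type _ := Com.Poly k XY ⧸ Com.relIdeal k

/-- The projection of `k⟨Δ(X)⟩` onto the quotient. -/
def NC.proj (k : Type*) [Field k] : NC.Poly k XY →+* NC.Quot k := (NC.relIdeal k).ringCon.mk'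

/-- The projection of `k[Δ(X)]` onto the quotient. -/
def Com.proj (k : Type*) [Field k] : Com.Poly k XY →+* Com.Quot k :=
  Ideal.Quotient.mk (Com.relIdeal k)

end DiffGS

end

/-! Since a weighted derivation kills `1` and `d_X` shifts letters, `d_X^n` sends x + y + 1 to
x^{(n)} + y^{(n)} + δ_{n,0} for every `lam` (`deriv_rel`, `iterate_deriv_rel_zero`). Hence the ideal
of these relations is stable under `d_X`, by the weighted Leibniz rule, and equals the differential
ideal of `sHat`.

A homomorphism φ from A to a differential algebra R must extend by z^{(n)} ↦ d^n(φ z). This kills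
the relations, because d^n is applied to φ(x + y + 1) = 0. Compatibility with the derivations and
uniqueness need checking only on letters (`exists_free_structure`).

The leading word of the n-th relation is the single letter x^{(n)} (`isLeading_rel`). The only
compositions within the allowed degree are therefore those of a relation with itself, which vanish,
and the irreducible words are those without any x^{(n)}.

For the basis, no composition-diamond lemma is used. The substitution x^{(m)} ↦ -y^{(m)} - δ_{m,0}
kills the relations and fixes words in the y^{(m)}, so it descends to a left inverse of the
projection on these words. This gives independence; the relations themselves give spanning
(`exists_basis_of_retraction`). -/

noncomputable section

namespace DiffGS

/-! ### Quotients, homomorphisms out of A, and the universal property, for both settings at once. -/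

section Generic

variable {k : Type u} [Field k] {lam : k}

/-- Both derivations obey the same weighted Leibniz rule, so the elements on which `ψ` commutes with
them form a subalgebra. -/
theorem IsWeightedDerivation.comm_of_adjoin_eq_top {D R : Type*} [Ring D] [Algebra k D] [Ring R]
    [Algebra k R] {dD : D →ₗ[k] D} {d : R →ₗ[k] R} (hD : IsWeightedDerivation lam dD)
    (hd : IsWeightedDerivation lam d) (ψ : D →ₐ[k] R) {s : Set D} (hs : Algebra.adjoin k s = ⊤)
    (h : ∀ z ∈ s, ψ (dD z) = d (ψ z)) (z : D) : ψ (dD z) = d (ψ z) := by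
  have hz : z ∈ Algebra.adjoin k s := hs ▸ Algebra.mem_top
  induction hz using Algebra.adjoin_induction with
  | mem x hx => exact h x hx
  | algebraMap r => simp [Algebra.algebraMap_eq_smul_one, hD.map_one, hd.map_one]
  | add x y _ _ hx hy => simp [hx, hy]
  | mul x y _ _ hx hy => simp [hD.leibniz, hd.leibniz, hx, hy]

/-- The derivation induced on a quotient. -/
theorem IsWeightedDerivation.of_surjective {P D : Type*} [Ring P] [Algebra k P] [Ring D]
    [Algebra k D] {d : P →ₗ[k] P} (hd : IsWeightedDerivation lam d) {π : P →ₐ[k] D}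
    (hπ : Function.Surjective π) {dD : D →ₗ[k] D} (h : ∀ f, dD (π f) = π (d f)) :
    IsWeightedDerivation lam dD where
  map_one := by rw [← _root_.map_one π, h, hd.map_one, map_zero]
  leibniz a b := by
    obtain ⟨a, rfl⟩ := hπ a
    obtain ⟨b, rfl⟩ := hπ b
    simp [← map_mul, h, hd.leibniz]

/-- Formulated for an arbitrary surjection, so that the `RingCon` quotient and the `Ideal` quotient
are treated alike. -/
theorem exists_linearMap_of_surjective {P D E : Type*} [AddCommGroup P] [Module k P]
    [AddCommGroup D] [Module k D] [AddCommGroup E] [Module k E] (π : P →ₗ[k] D)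
    (hπ : Function.Surjective π) (g : P →ₗ[k] E) (h : ∀ f, π f = 0 → g f = 0) :
    ∃ g' : D →ₗ[k] E, ∀ f, g' (π f) = g f := by
  refine ⟨(LinearMap.ker π).liftQ g (fun f hf => h f hf) ∘ₗ
    (π.quotKerEquivOfSurjective hπ).symm.toLinearMap, fun f => ?_⟩
  have : (π.quotKerEquivOfSurjective hπ).symm (π f) = Submodule.Quotient.mk f := by
    rw [LinearEquiv.symm_apply_eq]; rfl
  simp only [LinearMap.comp_apply, LinearEquiv.coe_coe, this]
  exact Submodule.liftQ_apply _ _ _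

theorem exists_algHom_of_surjective {P D E : Type*} [Ring P] [Algebra k P]
    [Ring D] [Algebra k D] [Ring E] [Algebra k E] (π : P →ₐ[k] D)
    (hπ : Function.Surjective π) (g : P →ₐ[k] E) (h : ∀ f, π f = 0 → g f = 0) :
    ∃ g' : D →ₐ[k] E, ∀ f, g' (π f) = g f := by
  obtain ⟨g', hg'⟩ := exists_linearMap_of_surjective π.toLinearMap hπ g.toLinearMap h
  simp only [AlgHom.toLinearMap_apply] at hg'
  refine ⟨AlgHom.ofLinearMap g' ?_ fun a b => ?_, hg'⟩
  · rw [← map_one π, hg', map_one]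
  · obtain ⟨a, rfl⟩ := hπ a
    obtain ⟨b, rfl⟩ := hπ b
    rw [← map_mul, hg', hg', hg', map_mul]

theorem AlgA.gen_relation : AlgA.gen k genX + AlgA.gen k genY + 1 = 0 :=
  Ideal.Quotient.eq_zero_iff_mem.2 (Ideal.subset_span rfl)

/-- `D` need not be commutative, so `MvPolynomial.aeval` into `D` is not available. The map goes
through k[t], with y ↦ t and x ↦ -t - 1, and then evaluates t at the single element `v genY`. -/
theorem AlgA.exists_algHom {D : Type*} [Ring D] [Algebra k D] (v : XY → D)
    (h : v genX + v genY + 1 = 0) : ∃ i : AlgA k →ₐ[k] D, ∀ z, i (AlgA.gen k z) = v z := by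
  let p : XY → Polynomial k := ![Polynomial.X, -Polynomial.X - 1]
  have hp : ∀ a ∈ Ideal.span {(MvPolynomial.X genX + MvPolynomial.X genY + 1 : MvPolynomial XY k)},
      MvPolynomial.aeval p a = 0 := fun a ha => by
    induction ha using Submodule.span_induction with
    | mem x hx => rw [Set.mem_singleton_iff.1 hx]; simp [p, genX, genY, sub_eq_add_neg]
    | zero => simp
    | add x y _ _ hx hy => simp [hx, hy]
    | smul a x _ hx => simp [hx]
  refine ⟨(Polynomial.aeval (v genY)).comp (Ideal.Quotient.liftₐ _ (MvPolynomial.aeval p) hp),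
    fun z => ?_⟩
  have hx : v genX = -v genY - 1 := by
    rw [add_assoc] at h; rw [eq_neg_of_add_eq_zero_left h]; abel
  have hX : (Polynomial.aeval (v genY)).comp (Ideal.Quotient.liftₐ _ (MvPolynomial.aeval p) hp)
      (AlgA.gen k z) = Polynomial.aeval (v genY) (MvPolynomial.aeval p (MvPolynomial.X z)) := rfl
  rw [hX, MvPolynomial.aeval_X]
  fin_cases z
  · simp [p, genY]
  · simpa [p, genX] using hx.symm

theorem AlgA.algHom_ext {D : Type*} [Ring D] [Algebra k D] {φ ψ : AlgA k →ₐ[k] D}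
    (h : ∀ z, φ (AlgA.gen k z) = ψ (AlgA.gen k z)) : φ = ψ :=
  Ideal.Quotient.algHom_ext _ (MvPolynomial.algHom_ext h)

theorem letter_cases (c : Letter XY) : ∃ z n, c = letter z n := ⟨(ofLex c).2, (ofLex c).1, rfl⟩

@[simp] theorem next_letter {X : Type*} (z : X) (n : ℕ) : (letter z n).next = letter z (n + 1) :=
  rfl

theorem letter_injective {X : Type*} {z : X} : Function.Injective (letter z) :=
  fun _ _ h => (Prod.ext_iff.1 (toLex.injective h)).1

theorem IsWeightedDerivation.iterate_gen_relation {R : Type*} [Ring R] [Algebra k R]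
    {d : R →ₗ[k] R} (hd : IsWeightedDerivation lam d) (φ : AlgA k →ₐ[k] R) (m : ℕ) :
    d^[m] (φ (AlgA.gen k genX)) + d^[m] (φ (AlgA.gen k genY)) + (if m = 0 then 1 else 0) = 0 := by
  -- The term δ_{m,0} is the m-th derivative of 1, so the whole sum is d^m applied to the image of x
  -- + y + 1.
  have h1 : (if m = 0 then (1 : R) else 0) = d^[m] 1 := by
    cases m with
    | zero => rfl
    | succ n => simp [hd.map_one]
  rw [h1, ← iterate_map_add, ← iterate_map_add, ← map_add, ← _root_.map_one φ, ← map_add,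
    AlgA.gen_relation, map_zero, iterate_map_zero]

/-- The universal property of a quotient `π : P → D` by a differential ideal containing the
relations, given the extension of homomorphisms to `P`. -/
theorem exists_free_structure {P D : Type*} [Ring P] [Algebra k P] [Ring D] [Algebra k D]
    (π : P →ₐ[k] D) (hπ : Function.Surjective π) {d : P →ₗ[k] P} (hd : IsWeightedDerivation lam d)
    (v : Letter XY → P) (hv : Algebra.adjoin k (Set.range v) = ⊤) (hdv : ∀ c, d (v c) = v c.next)
    (hker : ∀ f, π f = 0 → π (d f) = 0)
    (hrel : π (v (letter genX 0)) + π (v (letter genY 0)) + 1 = 0) :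
    ∃ (dbar : D →ₗ[k] D) (iA : AlgA k →ₐ[k] D), (∀ f, dbar (π f) = π (d f)) ∧
      (∀ z, iA (AlgA.gen k z) = π (v (letter z 0))) ∧ IsWeightedDerivation lam dbar ∧
      ∀ (R : Type w) [Ring R] [Algebra k R] (dR : R →ₗ[k] R), IsWeightedDerivation lam dR →
        ∀ φ : AlgA k →ₐ[k] R,
          (∃ ψ₀ : P →ₐ[k] R, (∀ z n, ψ₀ (v (letter z n)) = dR^[n] (φ (AlgA.gen k z))) ∧
            ∀ f, π f = 0 → ψ₀ f = 0) →
          ∃! ψ : D →ₐ[k] R, (∀ z, ψ (dbar z) = dR (ψ z)) ∧ ψ.comp iA = φ := by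
  obtain ⟨dbar, hdbar⟩ := exists_linearMap_of_surjective π.toLinearMap hπ (π.toLinearMap ∘ₗ d) hker
  simp only [AlgHom.toLinearMap_apply, LinearMap.comp_apply] at hdbar
  obtain ⟨iA, hiA⟩ := AlgA.exists_algHom (D := D) (k := k) (fun z => π (v (letter z 0))) hrel
  have hdD := hd.of_surjective hπ hdbar
  have hgen : Algebra.adjoin k (Set.range (π ∘ v)) = ⊤ := by
    rw [Set.range_comp, ← AlgHom.map_adjoin, hv, Algebra.map_top, AlgHom.range_eq_top]
    exact hπ
  refine ⟨dbar, iA, hdbar, hiA, hdD, ?_⟩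
  -- The extension `ψ₀` is supplied separately for each `R`: on a polynomial ring it comes from
  -- evaluation, which requires `R` commutative.
  rintro R _ _ dR hdR φ ⟨ψ₀, hψ₀, hψ₀ker⟩
  obtain ⟨ψ, hψ⟩ := exists_algHom_of_surjective π hπ ψ₀ hψ₀ker
  refine ⟨ψ, ⟨?_, AlgA.algHom_ext fun z => ?_⟩, ?_⟩
  · refine hdD.comm_of_adjoin_eq_top hdR ψ hgen ?_
    rintro _ ⟨c, rfl⟩
    obtain ⟨z, n, rfl⟩ := letter_cases c
    simp only [Function.comp_apply, hdbar, hdv, hψ, hψ₀, next_letter]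
    exact Function.iterate_succ_apply' _ _ _
  · simp [hiA, hψ, hψ₀]
  · rintro ψ' ⟨hψ'd, hψ'⟩
    refine AlgHom.ext_of_adjoin_eq_top hgen ?_
    rintro _ ⟨c, rfl⟩
    obtain ⟨z, n, rfl⟩ := letter_cases c
    simp only [Function.comp_apply, hψ, hψ₀]
    -- The value at z^{(n+1)} is forced to be the derivative of the value at z^{(n)}, and φ fixes
    -- the value at z^{(0)}.
    induction n with
    | zero => simp [← hψ', hiA]
    | succ n ih => rw [← next_letter, ← hdv, ← hdbar, hψ'd, ih, Function.iterate_succ_apply']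

/-- The images of a multiplicatively closed set of words form a basis of the quotient if they
generate it as an algebra and a linear map recovers each such word from its image. -/
theorem exists_basis_of_retraction {W P D : Type*} [AddCommGroup P] [Module k P] [Ring D]
    [Algebra k D] (mono : W → P) (hmono : LinearIndependent k mono) (π : P →ₗ[k] D) (Y : Set W)
    (σ : D →ₗ[k] P) (hσ : ∀ p ∈ Y, σ (π (mono p)) = mono p) (s : Set D)
    (hs : Algebra.adjoin k s = ⊤) (hY : (Submonoid.closure s : Set D) ⊆ (π ∘ mono) '' Y) :
    ∃ b : Module.Basis Y k D, ∀ p, b p = π (mono p.1) := by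
  have hli : LinearIndependent k fun p : Y => π (mono p.1) := by
    -- Independence may be tested after applying `σ`, which returns the original words.
    refine LinearIndependent.of_comp σ ?_
    have : (σ ∘ fun p : Y => π (mono p.1)) = fun p : Y => mono p.1 :=
      funext fun p => hσ p.1 p.2
    rw [this]
    exact hmono.comp _ Subtype.val_injective
  refine ⟨Module.Basis.mk hli ?_, fun p => Module.Basis.mk_apply _ _ _⟩
  rw [← Algebra.top_toSubmodule, ← hs, Algebra.adjoin_eq_span]
  refine Submodule.span_mono (hY.trans ?_)
  rintro _ ⟨p, hp, rfl⟩
  exact ⟨⟨p, hp⟩, rfl⟩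

end Generic

end DiffGS

end

noncomputable section

namespace DiffGS

namespace NC

/-! ### The derivation on noncommutative polynomials. -/

section Deriv

variable {k : Type u} [Field k] {X : Type v} (lam : k)

theorem mono_one : mono k (1 : Word X) = 1 := map_one _

theorem mono_mul (p q : Word X) : mono k (p * q) = mono k p * mono k q := map_mul _ p q

theorem mono_eq_single (p : Word X) : mono k p = MonoidAlgebra.single p 1 := rfl

theorem induction_mono {motive : Poly k X → Prop} (f : Poly k X) (zero : motive 0)
    (add : ∀ f g, motive f → motive g → motive (f + g))
    (smul : ∀ (r : k) f, motive f → motive (r • f)) (mono : ∀ p, motive (mono k p)) : motive f := by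
  induction f using MonoidAlgebra.induction_linear with
  | zero => exact zero
  | add f g hf hg => exact add f g hf hg
  | single p r =>
    have := smul r _ (mono p)
    rwa [mono_eq_single, MonoidAlgebra.smul_single', mul_one] at this

@[simp] theorem deriv_mono (p : Word X) :
    deriv lam (mono k p) = derivWord lam (FreeMonoid.toList p) := by
  simp [deriv, mono_eq_single]

/-- The recursion splits off the first letter only; this is the Leibniz rule for a splitting at any
place, from which the general rule follows by bilinearity. -/
theorem derivWord_append (p q : List (Letter X)) : derivWord lam (p ++ q) =
    derivWord lam p * mono k (FreeMonoid.ofList q) + mono k (FreeMonoid.ofList p) * derivWord lam q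
      + lam • (derivWord lam p * derivWord lam q) := by
  induction p with
  | nil => simp [derivWord, mono_one]
  | cons c p ih =>
    have h1 : mono k (FreeMonoid.ofList (p ++ q)) =
      mono k (FreeMonoid.ofList p) * mono k (FreeMonoid.ofList q) := mono_mul _ _
    have h2 : mono k (FreeMonoid.ofList (c :: p)) = var k c * mono k (FreeMonoid.ofList p) :=
      mono_mul (FreeMonoid.of c) _
    simp only [List.cons_append, derivWord, ih, h1, h2, add_mul, mul_add, mul_assoc, smul_add,
      smul_mul_assoc, mul_smul_comm]
    abel

theorem isWeightedDerivation_deriv :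
    IsWeightedDerivation lam (deriv lam : Poly k X →ₗ[k] Poly k X) where
  map_one := by rw [← mono_one, deriv_mono]; rfl
  leibniz a b := by
    induction a using induction_mono with
    | zero => simp
    | add f g hf hg => simp only [add_mul, map_add, hf, hg, smul_add]; abel
    | smul r f hf => simp only [smul_mul_assoc, map_smul, hf, smul_add, smul_comm r lam]
    | mono p =>
      induction b using induction_mono with
      | zero => simp
      | add f g hf hg => simp only [mul_add, map_add, hf, hg, smul_add]; abel
      | smul r f hf => simp only [mul_smul_comm, map_smul, hf, smul_add, smul_comm r lam]
      | mono q =>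
        rw [← mono_mul, deriv_mono, deriv_mono, deriv_mono, FreeMonoid.toList_mul,
          derivWord_append, FreeMonoid.ofList_toList, FreeMonoid.ofList_toList]

@[simp] theorem deriv_var (c : Letter X) : deriv lam (var k c) = var k c.next := by
  rw [var, deriv_mono, FreeMonoid.toList_of]
  simp only [derivWord, mul_zero, smul_zero, add_zero]
  exact mul_one _

theorem adjoin_range_var : Algebra.adjoin k (Set.range (var k : Letter X → Poly k X)) = ⊤ := by
  refine Algebra.eq_top_iff.2 fun f => ?_
  induction f using induction_mono with
  | zero => exact zero_mem _
  | add f g hf hg => exact add_mem hf hg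
  | smul r f hf => exact Subalgebra.smul_mem _ hf r
  | mono p =>
    induction p using FreeMonoid.inductionOn with
    | one => rw [mono_one]; exact one_mem _
    | of c => exact Algebra.subset_adjoin ⟨c, rfl⟩
    | mul p q hp hq => rw [mono_mul]; exact mul_mem hp hq

/-- The homomorphism on `k⟨Δ(X)⟩` with prescribed values on the letters. -/
def lift {R : Type*} [Ring R] [Algebra k R] (g : Letter X → R) : Poly k X →ₐ[k] R :=
  MonoidAlgebra.lift k R (Word X) (FreeMonoid.lift g)

@[simp] theorem lift_mono {R : Type*} [Ring R] [Algebra k R] (g : Letter X → R) (p : Word X) :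
    lift g (mono k p) = FreeMonoid.lift g p := MonoidAlgebra.lift_of _ _

@[simp] theorem lift_var {R : Type*} [Ring R] [Algebra k R] (g : Letter X → R) (c : Letter X) :
    lift g (var k c) = g c := by simp [var]

theorem linearIndependent_mono : LinearIndependent k (mono k : Word X → Poly k X) := by
  have := (MonoidAlgebra.basis (Word X) k).linearIndependent
  convert this using 1
  ext p : 1
  simp [mono_eq_single]

end Deriv

/-! ### The noncommutative relation ideal, its quotient and the basis. -/

section Relations

variable {k : Type u} [Field k] (lam : k)

theorem deriv_rel (m : ℕ) : deriv lam (rel k m) = rel k (m + 1) := by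
  have : deriv lam (if m = 0 then (1 : Poly k XY) else 0) = 0 := by
    split_ifs
    exacts [(isWeightedDerivation_deriv lam).map_one, map_zero _]
  simp [rel, this]

theorem iterate_deriv_rel_zero (n : ℕ) : (deriv lam)^[n] (rel k 0) = rel k n := by
  induction n with
  | zero => rfl
  | succ n ih => rw [Function.iterate_succ_apply', ih, deriv_rel]

theorem sHat_eq : sHat k = {rel k 0} := rfl

theorem smul_mem_relIdeal (r : k) {f : Poly k XY} (hf : f ∈ relIdeal k) : r • f ∈ relIdeal k := by
  rw [Algebra.smul_def]
  exact TwoSidedIdeal.mul_mem_left _ _ _ hf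

theorem deriv_mem_relIdeal {f : Poly k XY} (hf : f ∈ relIdeal k) : deriv lam f ∈ relIdeal k := by
  induction hf using TwoSidedIdeal.span_induction with
  | mem x h =>
    obtain ⟨m, rfl⟩ := h
    exact TwoSidedIdeal.subset_span ⟨m + 1, (deriv_rel lam m).symm⟩
  | zero => rw [map_zero]; exact zero_mem _
  | add x y _ _ hx hy => rw [map_add]; exact add_mem hx hy
  | neg x _ hx => rw [map_neg]; exact neg_mem hx
  | left_absorb a x hx' hx =>
    -- The scalar is moved onto the factor d(x), which already lies in the ideal.
    rw [(isWeightedDerivation_deriv lam).leibniz, ← mul_smul_comm]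
    exact add_mem (add_mem (TwoSidedIdeal.mul_mem_left _ _ _ hx')
      (TwoSidedIdeal.mul_mem_left _ _ _ hx))
      (TwoSidedIdeal.mul_mem_left _ _ _ (smul_mem_relIdeal lam hx))
  | right_absorb b x hx' hx =>
    rw [(isWeightedDerivation_deriv lam).leibniz, ← smul_mul_assoc]
    exact add_mem (add_mem (TwoSidedIdeal.mul_mem_right _ _ _ hx)
      (TwoSidedIdeal.mul_mem_right _ _ _ hx'))
      (TwoSidedIdeal.mul_mem_right _ _ _ (smul_mem_relIdeal lam hx))

theorem diffIdeal_sHat : diffIdeal lam (sHat k) = relIdeal k := by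
  refine le_antisymm (sInf_le ⟨?_, fun f => deriv_mem_relIdeal lam⟩) (le_sInf fun I hI => ?_)
  · rintro _ rfl
    exact TwoSidedIdeal.subset_span ⟨0, rfl⟩
  · refine TwoSidedIdeal.span_le.2 ?_
    rintro _ ⟨m, rfl⟩
    induction m with
    | zero => exact hI.1 rfl
    | succ m ih => exact deriv_rel lam m ▸ hI.2 _ ih

/-- The projection onto the quotient as a homomorphism of algebras. -/
def projₐ (k : Type u) [Field k] : Poly k XY →ₐ[k] Quot k :=
  { proj k with commutes' := fun _ => rfl }

theorem projₐ_surjective : Function.Surjective (projₐ k) := RingCon.mk'_surjective _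

theorem projₐ_eq_zero_iff {f : Poly k XY} : projₐ k f = 0 ↔ f ∈ relIdeal k :=
  (RingCon.eq _).trans (TwoSidedIdeal.mem_iff _ _).symm

theorem projₐ_rel (m : ℕ) : projₐ k (rel k m) = 0 :=
  projₐ_eq_zero_iff.2 (TwoSidedIdeal.subset_span ⟨m, rfl⟩)

theorem map_eq_zero_of_projₐ_eq_zero {R : Type*} [Ring R] [Algebra k R] (g : Poly k XY →ₐ[k] R)
    (hg : ∀ m, g (rel k m) = 0) (f : Poly k XY) (hf : projₐ k f = 0) : g f = 0 := by
  have : relIdeal k ≤ TwoSidedIdeal.ker g := by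
    refine TwoSidedIdeal.span_le.2 ?_
    rintro _ ⟨m, rfl⟩
    exact (TwoSidedIdeal.mem_ker _).2 (hg m)
  exact (TwoSidedIdeal.mem_ker _).1 (this (projₐ_eq_zero_iff.1 hf))

theorem free_quot : ∃ (dbar : Quot k →ₗ[k] Quot k) (iA : AlgA k →ₐ[k] Quot k),
    (∀ f, dbar (proj k f) = proj k (deriv lam f)) ∧
    (∀ z, iA (AlgA.gen k z) = proj k (var k (letter z 0))) ∧
    IsFreeDiffAlgOn.{u, w} lam dbar iA := by
  obtain ⟨dbar, iA, h1, h2, h3, h4⟩ := exists_free_structure.{u, w} (projₐ k) projₐ_surjective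
    (isWeightedDerivation_deriv lam) (var k) adjoin_range_var (deriv_var lam)
    (fun f hf => projₐ_eq_zero_iff.2 (deriv_mem_relIdeal lam (projₐ_eq_zero_iff.1 hf)))
    (by simpa [rel] using projₐ_rel (k := k) 0)
  refine ⟨dbar, iA, h1, h2, h3, fun R _ _ d hd φ => h4 R d hd φ ?_⟩
  -- The only possible choice: z^{(n)} goes to the n-th derivative of φ(z).
  refine ⟨lift fun c => d^[(ofLex c).1] (φ (AlgA.gen k (ofLex c).2)), fun z n => by simp [letter],
    map_eq_zero_of_projₐ_eq_zero _ fun m => ?_⟩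
  rw [← hd.iterate_gen_relation φ m]
  simp only [rel, map_add, lift_var]
  congr 1
  split_ifs <;> simp

/-- The words in the letters `y^{(m)}`. -/
def yWords : Submonoid (Word XY) :=
  Submonoid.closure (Set.range fun m : ℕ => FreeMonoid.of (letter genY m))

/-- The closure suits the substitution and the basis; avoidance of the x^{(m)} is what
irreducibility says. -/
theorem mem_yWords_iff {p : Word XY} : p ∈ yWords ↔ ∀ m, letter genX m ∉ FreeMonoid.toList p := by
  refine ⟨fun hp => ?_, fun hp => ?_⟩
  · induction hp using Submonoid.closure_induction with
    | mem x hx =>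
      obtain ⟨n, rfl⟩ := hx
      simp [letter, genX, genY]
    | one => simp
    | mul p q _ _ hp hq => intro m; simp [hp m, hq m]
  · induction p using FreeMonoid.inductionOn' with
    | one => exact one_mem _
    | of_mul c p ih =>
      simp only [FreeMonoid.toList_of_mul, List.mem_cons, not_or] at hp
      refine mul_mem ?_ (ih fun m => (hp m).2)
      obtain ⟨z, n, rfl⟩ := letter_cases c
      fin_cases z
      · exact Submonoid.subset_closure ⟨n, rfl⟩
      · exact absurd rfl (hp n).1

/-- The values on the letters of the substitution eliminating the letters `x^{(m)}`. -/
def elim (k : Type u) [Field k] (c : Letter XY) : Poly k XY :=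
  if (ofLex c).2 = genX then
    -var k (letter genY (ofLex c).1) - (if (ofLex c).1 = 0 then 1 else 0) else var k c

@[simp] theorem elim_genX (m : ℕ) : elim k (letter genX m) =
    -var k (letter genY m) - (if m = 0 then 1 else 0) := if_pos rfl

@[simp] theorem elim_genY (m : ℕ) : elim k (letter genY m) = var k (letter genY m) :=
  if_neg (by simp [letter, genX, genY])

theorem elim_rel (m : ℕ) : lift (elim k) (rel k m) = 0 := by
  have : lift (elim k) (if m = 0 then (1 : Poly k XY) else 0) = if m = 0 then 1 else 0 := by
    split_ifs <;> simp
  rw [rel, map_add, map_add, this, lift_var, lift_var, elim_genX, elim_genY]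
  abel

theorem elim_mono {p : Word XY} (hp : p ∈ yWords) : lift (elim k) (mono k p) = mono k p := by
  induction hp using Submonoid.closure_induction with
  | mem x hx =>
    obtain ⟨n, rfl⟩ := hx
    exact (lift_var _ _).trans (elim_genY n)
  | one => simp [mono_one]
  | mul p q _ _ hp hq => rw [mono_mul, map_mul, hp, hq]

theorem exists_basis_yWords : ∃ b : Module.Basis (yWords : Set (Word XY)) k (Quot k),
    ∀ p, b p = proj k (mono k p.1) := by
  obtain ⟨σ, hσ⟩ := exists_algHom_of_surjective (projₐ k) projₐ_surjective (lift (elim k))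
    (map_eq_zero_of_projₐ_eq_zero _ elim_rel)
  refine exists_basis_of_retraction (mono k) linearIndependent_mono (projₐ k).toLinearMap _
    σ.toLinearMap (fun p hp => (hσ _).trans (elim_mono hp))
    (Set.range fun m => projₐ k (var k (letter genY m))) ?_ ?_
  · rw [← top_le_iff, ← (AlgHom.range_eq_top (projₐ k)).2 projₐ_surjective, ← Algebra.map_top,
      ← adjoin_range_var, AlgHom.map_adjoin, Algebra.adjoin_le_iff]
    rintro _ ⟨_, ⟨c, rfl⟩, rfl⟩
    obtain ⟨z, n, rfl⟩ := letter_cases c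
    have hy := Algebra.subset_adjoin (R := k)
      (Set.mem_range_self (f := fun m => projₐ k (var k (letter genY m))) n)
    fin_cases z
    · exact hy
    · have h := projₐ_rel (k := k) n
      -- In the quotient the relation expresses x^{(n)} through y^{(n)} and a constant, so the
      -- classes of the y^{(m)} generate.
      rw [rel, map_add, map_add, add_assoc] at h
      have h' := eq_neg_of_add_eq_zero_left h
      refine SetLike.mem_coe.2 (h'.symm ▸ neg_mem (add_mem hy ?_))
      split_ifs
      · rw [map_one]; exact one_mem _
      · rw [map_zero]; exact zero_mem _
  · have : (fun m => projₐ k (var k (letter genY m))) = ((projₐ k : Poly k XY →* Quot k).comp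
      (MonoidAlgebra.of k (Word XY))) ∘ fun m => FreeMonoid.of (letter genY m) := rfl
    rw [this, Set.range_comp, ← MonoidHom.map_mclosure]
    rfl

end Relations

/-! ### Leading words, irreducible words and compositions in the noncommutative setting. -/

section Leading

theorem WordLT.asymm {X : Type*} [LinearOrder X] {p q : Word X} (h : WordLT p q) :
    ¬ WordLT q p := Std.Asymm.asymm (r := List.Shortlex (· < ·)) _ _ h

/-- Turns every word assumed to be leading in the definitions into the explicit letter found in
`isLeading_rel`. -/
theorem IsLeading.unique {k : Type*} [Field k] {X : Type*} [LinearOrder X] {f : Poly k X}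
    {p q : Word X} (hp : IsLeading f p) (hq : IsLeading f q) : p = q := by
  rcases hp.2 q hq.1 with h | h
  · exact h.symm
  · exact (hq.2 p hp.1).resolve_right h.asymm

variable {k : Type u} [Field k] (lam : k)

open Classical in
theorem coeff_rel (m : ℕ) (p : Word XY) : (rel k m).coeff p =
    (if p = FreeMonoid.of (letter genX m) then 1 else 0) +
    (if p = FreeMonoid.of (letter genY m) then 1 else 0) +
    (if m = 0 ∧ p = 1 then 1 else 0) := by
  have h1 : (if m = 0 then (1 : Poly k XY) else 0).coeff p = if m = 0 ∧ p = 1 then 1 else 0 := by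
    by_cases hm : m = 0
    · simp [hm, MonoidAlgebra.one_def, Finsupp.single_apply, eq_comm]
    · simp [hm]
  simp [rel, h1, var, mono_eq_single, Finsupp.single_apply, eq_comm]

theorem coeff_rel_self (m : ℕ) : (rel k m).coeff (FreeMonoid.of (letter genX m)) = 1 := by
  simp [coeff_rel, letter, genX, genY, FreeMonoid.of_injective.eq_iff]

theorem isLeading_rel (m : ℕ) : IsLeading (rel k m) (FreeMonoid.of (letter genX m)) := by
  refine ⟨by simp [coeff_rel_self], fun q hq => ?_⟩
  rw [coeff_rel] at hq
  by_cases h1 : q = FreeMonoid.of (letter genX m)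
  · exact Or.inl h1
  refine Or.inr ?_
  by_cases h2 : q = FreeMonoid.of (letter genY m)
  · subst h2
    refine (List.shortlex_singleton_iff _ _).2 ?_
    -- The derivative orders agree, so the comparison is y < x, that is `0 < 1` in `Fin 2`.
    exact Prod.Lex.right _ (by decide)
  · have : q = 1 := by by_contra h; simp [h1, h2, h] at hq
    subst this
    exact List.Shortlex.of_length_lt (by simp)

theorem isLeading_iterate_iff {n : ℕ} {l : Word XY} :
    IsLeading ((deriv lam)^[n] (rel k 0)) l ↔ l = FreeMonoid.of (letter genX n) := by
  rw [iterate_deriv_rel_zero]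
  exact ⟨fun h => h.unique (isLeading_rel n), fun h => h ▸ isLeading_rel n⟩

theorem DIrr_sHat : DIrr lam (sHat k) = (yWords : Set (Word XY)) := by
  ext p
  rw [SetLike.mem_coe, mem_yWords_iff, DIrr, Set.mem_ofPred_eq, sHat_eq]
  simp only [Set.mem_singleton_iff, exists_eq_left, isLeading_iterate_iff]
  constructor
  · intro h m hm
    obtain ⟨a, b, hab⟩ := List.append_of_mem hm
    exact h ⟨m, _, FreeMonoid.ofList a, FreeMonoid.ofList b, rfl, by
      apply FreeMonoid.toList.injective; simp [hab]⟩
  · rintro h ⟨m, _, a, b, rfl, rfl⟩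
    exact h m (by simp)

theorem isGSBasis_sHat : IsGSBasis lam (sHat k) where
  monic := by
    rintro _ rfl
    exact ⟨_, isLeading_rel 0, coeff_rel_self 0⟩
  intersection := by
    rintro _ rfl _ rfl p q hp hq i j pᵢ qⱼ a b hpi hqj hw hlt
    rw [hp.unique (isLeading_rel 0), hq.unique (isLeading_rel 0),
      (isLeading_iterate_iff lam).1 hpi] at hlt
    rw [(isLeading_iterate_iff lam).1 hpi, (isLeading_iterate_iff lam).1 hqj] at hw ⊢
    -- The bound is now 1 + |a| < 1 + 1. Hence a and b are empty, the two letters agree, i = j, and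
    -- the composition is a difference of equal terms.
    simp only [FreeMonoid.length_mul, FreeMonoid.length_of] at hlt
    have hlen := congrArg FreeMonoid.length hw
    simp only [FreeMonoid.length_mul, FreeMonoid.length_of] at hlen
    obtain rfl : a = 1 := FreeMonoid.length_eq_zero.1 (by omega)
    obtain rfl : b = 1 := FreeMonoid.length_eq_zero.1 (by omega)
    rw [mul_one, one_mul] at hw
    obtain rfl := letter_injective (FreeMonoid.of_injective hw)
    simp only [mono_one, mul_one, one_mul, sub_self]
    exact zero_mem _
  inclusion := by
    rintro _ rfl _ rfl i j pᵢ qⱼ a b hpi hqj hw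
    rw [(isLeading_iterate_iff lam).1 hpi, (isLeading_iterate_iff lam).1 hqj] at hw ⊢
    have hlen := congrArg FreeMonoid.length hw
    simp only [FreeMonoid.length_mul, FreeMonoid.length_of] at hlen
    obtain rfl : a = 1 := FreeMonoid.length_eq_zero.1 (by omega)
    obtain rfl : b = 1 := FreeMonoid.length_eq_zero.1 (by omega)
    rw [mul_one, one_mul] at hw
    obtain rfl := letter_injective (FreeMonoid.of_injective hw)
    rw [mono_one, mul_one, one_mul, sub_self]
    exact zero_mem _

end Leading

end NC

end DiffGS

end

noncomputable section

namespace DiffGS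

namespace Com

/-! ### The derivation on commutative polynomials. -/

section Deriv

variable {k : Type u} [Field k] {X : Type v} (lam : k)

theorem mono_zero : mono k (0 : Word X) = 1 := rfl

theorem mono_add (p q : Word X) : mono k (p + q) = mono k p * mono k q := by
  simp [mono, MvPolynomial.monomial_mul]

theorem mono_single (c : Letter X) : mono k (Finsupp.single c 1) = var k c := rfl

theorem induction_mono {motive : Poly k X → Prop} (f : Poly k X)
    (add : ∀ f g, motive f → motive g → motive (f + g))
    (smul : ∀ (r : k) f, motive f → motive (r • f)) (mono : ∀ p, motive (mono k p)) : motive f := by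
  induction f using MvPolynomial.induction_on' with
  | monomial p r =>
    have := smul r _ (mono p)
    rwa [Com.mono, MvPolynomial.smul_monomial, smul_eq_mul, mul_one] at this
  | add f g hf hg => exact add f g hf hg

@[simp] theorem deriv_mono (p : Word X) : deriv lam (mono k p) = derivWord lam p := by
  have := (MvPolynomial.basisMonomials (Letter X) k).constr_basis k (derivWord lam) p
  rwa [MvPolynomial.coe_basisMonomials] at this

/-- The fold carries the pair (p, d_X p), since a Leibniz step needs p itself. -/
theorem foldr_derivStep_fst (m : Multiset (Letter X)) :
    (Multiset.foldr (derivStep lam) (1, 0) m).1 = (m.map (var k)).prod := by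
  induction m using Multiset.induction with
  | empty => simp
  | cons c m ih => rw [Multiset.foldr_cons, Multiset.map_cons, Multiset.prod_cons, ← ih]; rfl

theorem foldr_derivStep_add (m n : Multiset (Letter X)) :
    (Multiset.foldr (derivStep lam) (1, 0) (m + n)).2 =
      (Multiset.foldr (derivStep lam) (1, 0) m).2 * (n.map (var k)).prod +
      (m.map (var k)).prod * (Multiset.foldr (derivStep lam) (1, 0) n).2 +
      lam • ((Multiset.foldr (derivStep lam) (1, 0) m).2 *
        (Multiset.foldr (derivStep lam) (1, 0) n).2) := by
  induction m using Multiset.induction with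
  | empty => simp
  | cons c m ih =>
    simp only [Multiset.cons_add, Multiset.foldr_cons, derivStep, ih, foldr_derivStep_fst,
      Multiset.map_add, Multiset.prod_add, Multiset.map_cons, Multiset.prod_cons,
      MvPolynomial.smul_eq_C_mul]
    ring

theorem prod_map_var_toMultiset (p : Word X) :
    ((Finsupp.toMultiset p).map (var k)).prod = mono k p := by
  induction p using Finsupp.induction_linear with
  | zero => simp [mono_zero]
  | add p q hp hq => rw [map_add, Multiset.map_add, Multiset.prod_add, hp, hq, mono_add]
  | single c n =>
    simp [Finsupp.toMultiset_single, Multiset.map_nsmul, Multiset.prod_nsmul, var, mono,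
      MvPolynomial.X_pow_eq_monomial]

theorem derivWord_add (p q : Word X) : derivWord lam (p + q) =
    derivWord lam p * mono k q + mono k p * derivWord lam q
      + lam • (derivWord lam p * derivWord lam q) := by
  simp only [derivWord, map_add, foldr_derivStep_add, prod_map_var_toMultiset]

theorem isWeightedDerivation_deriv :
    IsWeightedDerivation lam (deriv lam : Poly k X →ₗ[k] Poly k X) where
  map_one := by rw [← mono_zero, deriv_mono]; simp [derivWord]
  leibniz a b := by
    induction a using induction_mono with
    | add f g hf hg => simp only [add_mul, map_add, hf, hg, smul_add]; abel
    | smul r f hf => simp only [smul_mul_assoc, map_smul, hf, smul_add, smul_comm r lam]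
    | mono p =>
      induction b using induction_mono with
      | add f g hf hg => simp only [mul_add, map_add, hf, hg, smul_add]; abel
      | smul r f hf => simp only [mul_smul_comm, map_smul, hf, smul_add, smul_comm r lam]
      | mono q => rw [← mono_add, deriv_mono, deriv_mono, deriv_mono, derivWord_add]

@[simp] theorem deriv_var (c : Letter X) : deriv lam (var k c) = var k c.next := by
  rw [← mono_single, deriv_mono]
  simp [derivWord, derivStep]

theorem adjoin_range_var : Algebra.adjoin k (Set.range (var k : Letter X → Poly k X)) = ⊤ :=
  MvPolynomial.adjoin_range_X

theorem linearIndependent_mono : LinearIndependent k (mono k : Word X → Poly k X) := by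
  have := (MvPolynomial.basisMonomials (Letter X) k).linearIndependent
  rwa [MvPolynomial.coe_basisMonomials] at this

end Deriv

/-! ### The commutative relation ideal, its quotient and the basis. -/

section Relations

variable {k : Type u} [Field k] (lam : k)

theorem deriv_rel (m : ℕ) : deriv lam (rel k m) = rel k (m + 1) := by
  have : deriv lam (if m = 0 then (1 : Poly k XY) else 0) = 0 := by
    split_ifs
    exacts [(isWeightedDerivation_deriv lam).map_one, map_zero _]
  simp [rel, this]

theorem iterate_deriv_rel_zero (n : ℕ) : (deriv lam)^[n] (rel k 0) = rel k n := by
  induction n with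
  | zero => rfl
  | succ n ih => rw [Function.iterate_succ_apply', ih, deriv_rel]

theorem sHat_eq : sHat k = {rel k 0} := rfl

theorem deriv_mem_relIdeal {f : Poly k XY} (hf : f ∈ relIdeal k) : deriv lam f ∈ relIdeal k := by
  induction hf using Submodule.span_induction with
  | mem x h =>
    obtain ⟨m, rfl⟩ := h
    exact Ideal.subset_span ⟨m + 1, (deriv_rel lam m).symm⟩
  | zero => rw [map_zero]; exact zero_mem _
  | add x y _ _ hx hy => rw [map_add]; exact add_mem hx hy
  | smul a x hx' hx =>
    -- Here the scalar joins d(a), so that the last term is a multiple of d(x).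
    rw [smul_eq_mul, (isWeightedDerivation_deriv lam).leibniz, ← smul_mul_assoc]
    exact add_mem (add_mem (Ideal.mul_mem_left _ _ hx') (Ideal.mul_mem_left _ _ hx))
      (Ideal.mul_mem_left _ _ hx)

theorem diffIdeal_sHat : diffIdeal lam (sHat k) = relIdeal k := by
  refine le_antisymm (sInf_le ⟨?_, fun f => deriv_mem_relIdeal lam⟩) (le_sInf fun I hI => ?_)
  · rintro _ rfl
    exact Ideal.subset_span ⟨0, rfl⟩
  · refine Ideal.span_le.2 ?_
    rintro _ ⟨m, rfl⟩
    induction m with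
    | zero => exact hI.1 rfl
    | succ m ih => exact deriv_rel lam m ▸ hI.2 _ ih

theorem proj_rel (m : ℕ) : proj k (rel k m) = 0 :=
  Ideal.Quotient.eq_zero_iff_mem.2 (Ideal.subset_span ⟨m, rfl⟩)

theorem map_eq_zero_of_proj_eq_zero {R : Type*} [CommRing R] [Algebra k R]
    (g : Poly k XY →ₐ[k] R) (hg : ∀ m, g (rel k m) = 0) (f : Poly k XY) (hf : proj k f = 0) :
    g f = 0 := by
  have : relIdeal k ≤ RingHom.ker g := by
    refine Ideal.span_le.2 ?_
    rintro _ ⟨m, rfl⟩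
    exact hg m
  exact this (Ideal.Quotient.eq_zero_iff_mem.1 hf)

theorem free_quot : ∃ (dbar : Quot k →ₗ[k] Quot k) (iA : AlgA k →ₐ[k] Quot k),
    (∀ f, dbar (proj k f) = proj k (deriv lam f)) ∧
    (∀ z, iA (AlgA.gen k z) = proj k (var k (letter z 0))) ∧
    IsFreeCommDiffAlgOn.{u, w} lam dbar iA := by
  obtain ⟨dbar, iA, h1, h2, h3, h4⟩ := exists_free_structure.{u, w}
    (Ideal.Quotient.mkₐ k (relIdeal k)) (Ideal.Quotient.mkₐ_surjective _ _)
    (isWeightedDerivation_deriv lam) (var k) adjoin_range_var (deriv_var lam)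
    (fun f hf => Ideal.Quotient.eq_zero_iff_mem.2
      (deriv_mem_relIdeal lam (Ideal.Quotient.eq_zero_iff_mem.1 hf)))
    (by simpa [rel, proj] using proj_rel (k := k) 0)
  refine ⟨dbar, iA, h1, h2, h3, fun R _ _ d hd φ => h4 R d hd φ ?_⟩
  refine ⟨MvPolynomial.aeval fun c => d^[(ofLex c).1] (φ (AlgA.gen k (ofLex c).2)),
    fun z n => by simp [letter, var], map_eq_zero_of_proj_eq_zero _ fun m => ?_⟩
  rw [← hd.iterate_gen_relation φ m]
  simp only [rel, map_add, var, MvPolynomial.aeval_X]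
  congr 1
  split_ifs <;> simp

/-- The commutative words in the letters `y^{(m)}`. -/
def yWords : AddSubmonoid (Word XY) :=
  AddSubmonoid.closure (Set.range fun m : ℕ => Finsupp.single (letter genY m) 1)

theorem mem_yWords_iff {p : Word XY} : p ∈ yWords ↔ ∀ m, p (letter genX m) = 0 := by
  refine ⟨fun hp => ?_, fun hp => ?_⟩
  · induction hp using AddSubmonoid.closure_induction with
    | mem x hx =>
      obtain ⟨n, rfl⟩ := hx
      simp [letter, genX, genY]
    | zero => simp
    | add p q _ _ hp hq => intro m; simp [hp m, hq m]
  · rw [← Finsupp.sum_single p]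
    refine AddSubmonoid.sum_mem _ fun c hc => ?_
    obtain ⟨z, n, rfl⟩ := letter_cases c
    fin_cases z
    · have := AddSubmonoid.nsmul_mem yWords (AddSubmonoid.subset_closure ⟨n, rfl⟩)
        (p (letter genY n))
      rwa [Finsupp.smul_single, smul_eq_mul, mul_one] at this
    · exact absurd (hp n) (Finsupp.mem_support_iff.1 hc)

/-- The values on the letters of the substitution eliminating the letters `x^{(m)}`. -/
def elim (k : Type u) [Field k] (c : Letter XY) : Poly k XY :=
  if (ofLex c).2 = genX then
    -var k (letter genY (ofLex c).1) - (if (ofLex c).1 = 0 then 1 else 0) else var k c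

@[simp] theorem elim_genX (m : ℕ) : elim k (letter genX m) =
    -var k (letter genY m) - (if m = 0 then 1 else 0) := if_pos rfl

@[simp] theorem elim_genY (m : ℕ) : elim k (letter genY m) = var k (letter genY m) :=
  if_neg (by simp [letter, genX, genY])

theorem elim_rel (m : ℕ) : MvPolynomial.aeval (elim k) (rel k m) = 0 := by
  have : MvPolynomial.aeval (elim k) (if m = 0 then (1 : Poly k XY) else 0) =
      if m = 0 then 1 else 0 := by
    split_ifs <;> simp
  rw [rel, map_add, map_add, this, var, var, MvPolynomial.aeval_X, MvPolynomial.aeval_X,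
    elim_genX, elim_genY, var]
  abel

theorem elim_mono {p : Word XY} (hp : p ∈ yWords) :
    MvPolynomial.aeval (elim k) (mono k p) = mono k p := by
  induction hp using AddSubmonoid.closure_induction with
  | mem x hx =>
    obtain ⟨n, rfl⟩ := hx
    exact (MvPolynomial.aeval_X _ _).trans (elim_genY n)
  | zero => rw [mono_zero, map_one]
  | add p q _ _ hp hq => rw [mono_add, map_mul, hp, hq]

theorem exists_basis_yWords : ∃ b : Module.Basis (yWords : Set (Word XY)) k (Quot k),
    ∀ p, b p = proj k (mono k p.1) := by
  have hsurj := Ideal.Quotient.mkₐ_surjective k (relIdeal k)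
  obtain ⟨σ, hσ⟩ := exists_algHom_of_surjective _ hsurj (MvPolynomial.aeval (elim k))
    (map_eq_zero_of_proj_eq_zero _ elim_rel)
  refine exists_basis_of_retraction (mono k) linearIndependent_mono
    (Ideal.Quotient.mkₐ k (relIdeal k)).toLinearMap _
    σ.toLinearMap (fun p hp => (hσ _).trans (elim_mono hp))
    (Set.range fun m => proj k (var k (letter genY m))) ?_ ?_
  · rw [← top_le_iff, ← (AlgHom.range_eq_top _).2 hsurj, ← Algebra.map_top,
      ← adjoin_range_var, AlgHom.map_adjoin, Algebra.adjoin_le_iff]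
    rintro _ ⟨_, ⟨c, rfl⟩, rfl⟩
    obtain ⟨z, n, rfl⟩ := letter_cases c
    have hy := Algebra.subset_adjoin (R := k)
      (Set.mem_range_self (f := fun m => proj k (var k (letter genY m))) n)
    fin_cases z
    · exact hy
    · have h := proj_rel (k := k) n
      rw [rel, map_add, map_add, add_assoc] at h
      have h' := eq_neg_of_add_eq_zero_left h
      refine SetLike.mem_coe.2 (h'.symm ▸ neg_mem (add_mem hy ?_))
      split_ifs
      · rw [map_one]; exact one_mem _
      · rw [map_zero]; exact zero_mem _
  -- Words are written additively while their classes multiply, so the closure is handled by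
  -- induction.
  · intro a ha
    induction ha using Submonoid.closure_induction with
    | mem x hx =>
      obtain ⟨n, rfl⟩ := hx
      exact ⟨_, AddSubmonoid.subset_closure ⟨n, rfl⟩, rfl⟩
    | one => exact ⟨0, zero_mem _, map_one (proj k)⟩
    | mul x y _ _ hx hy =>
      obtain ⟨p, hp, rfl⟩ := hx
      obtain ⟨q, hq, rfl⟩ := hy
      refine ⟨p + q, add_mem hp hq, ?_⟩
      simp [mono_add]

end Relations

/-! ### Leading words, irreducible words and compositions in the commutative setting. -/

section Leading

/-- A multiset has only one decreasing arrangement, so the lists witnessing the two comparisons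
coincide and asymmetry of `List.Shortlex` applies. -/
theorem WordLT.asymm {X : Type*} [LinearOrder X] {p q : Word X} (h : WordLT p q) :
    ¬ WordLT q p := by
  rintro ⟨l', m', hl', hm', hlp', hmq', h'⟩
  obtain ⟨l, m, hl, hm, hlp, hmq, h⟩ := h
  obtain rfl : l = m' :=
    List.Perm.eq_of_pairwise' hl hm' (Multiset.coe_eq_coe.1 (hlp.trans hmq'.symm))
  obtain rfl : m = l' :=
    List.Perm.eq_of_pairwise' hm hl' (Multiset.coe_eq_coe.1 (hmq.trans hlp'.symm))
  exact Std.Asymm.asymm (r := List.Shortlex (· < ·)) _ _ h h'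

theorem IsLeading.unique {k : Type*} [Field k] {X : Type*} [LinearOrder X] {f : Poly k X}
    {p q : Word X} (hp : IsLeading f p) (hq : IsLeading f q) : p = q := by
  rcases hp.2 q hq.1 with h | h
  · exact h.symm
  · exact (hq.2 p hp.1).resolve_right h.asymm

variable {k : Type u} [Field k] (lam : k)

open Classical in
theorem coeff_rel (m : ℕ) (p : Word XY) : (rel k m).coeff p =
    (if p = Finsupp.single (letter genX m) 1 then 1 else 0) +
    (if p = Finsupp.single (letter genY m) 1 then 1 else 0) +
    (if m = 0 ∧ p = 0 then 1 else 0) := by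
  have h1 : (if m = 0 then (1 : Poly k XY) else 0).coeff p = if m = 0 ∧ p = 0 then 1 else 0 := by
    by_cases hm : m = 0
    · simp [hm, MvPolynomial.coeff_one, eq_comm]
    · simp [hm]
  rw [rel, MvPolynomial.coeff_add, MvPolynomial.coeff_add, h1, var, var, MvPolynomial.coeff_X,
    MvPolynomial.coeff_X]
  simp only [eq_comm]

theorem single_injective {X : Type*} :
    Function.Injective fun c : Letter X => (Finsupp.single c 1 : Word X) :=
  Finsupp.single_left_injective one_ne_zero

theorem coeff_rel_self (m : ℕ) : (rel k m).coeff (Finsupp.single (letter genX m) 1) = 1 := by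
  simp [coeff_rel, letter, genX, genY, single_injective.eq_iff]

theorem isLeading_rel (m : ℕ) : IsLeading (rel k m) (Finsupp.single (letter genX m) 1) := by
  refine ⟨by simp [coeff_rel_self], fun q hq => ?_⟩
  rw [coeff_rel] at hq
  by_cases h1 : q = Finsupp.single (letter genX m) 1
  · exact Or.inl h1
  refine Or.inr ?_
  by_cases h2 : q = Finsupp.single (letter genY m) 1
  · subst h2
    refine ⟨[letter genY m], [letter genX m], by simp, by simp, by simp, by simp,
      (List.shortlex_singleton_iff _ _).2 (Prod.Lex.right _ (by decide))⟩
  · have : q = 0 := by by_contra h; simp [h1, h2, h] at hq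
    subst this
    exact ⟨[], [letter genX m], by simp, by simp, by simp, by simp,
      List.Shortlex.of_length_lt (by simp)⟩

theorem isLeading_iterate_iff {n : ℕ} {l : Word XY} :
    IsLeading ((deriv lam)^[n] (rel k 0)) l ↔ l = Finsupp.single (letter genX n) 1 := by
  rw [iterate_deriv_rel_zero]
  exact ⟨fun h => h.unique (isLeading_rel n), fun h => h ▸ isLeading_rel n⟩

theorem DIrr_sHat : DIrr lam (sHat k) = (yWords : Set (Word XY)) := by
  ext p
  rw [SetLike.mem_coe, mem_yWords_iff, DIrr, Set.mem_ofPred_eq, sHat_eq]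
  simp only [Set.mem_singleton_iff, exists_eq_left, isLeading_iterate_iff]
  constructor
  · intro h m
    by_contra hm
    have hle : Finsupp.single (letter genX m) 1 ≤ p :=
      Finsupp.single_le_iff.2 (Nat.one_le_iff_ne_zero.2 hm)
    exact h ⟨m, _, p - Finsupp.single (letter genX m) 1, rfl, (add_tsub_cancel_of_le hle).symm⟩
  · rintro h ⟨m, _, a, rfl, rfl⟩
    simpa using h m

theorem isGSBasis_sHat : IsGSBasis lam (sHat k) where
  monic := by
    rintro _ rfl
    exact ⟨_, isLeading_rel 0, coeff_rel_self 0⟩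
  composition := by
    rintro _ rfl _ rfl p q hp hq i j pᵢ qⱼ a b hpi hqj hw hlt
    rw [hp.unique (isLeading_rel 0), hq.unique (isLeading_rel 0),
      (isLeading_iterate_iff lam).1 hpi] at hlt
    rw [(isLeading_iterate_iff lam).1 hpi, (isLeading_iterate_iff lam).1 hqj] at hw ⊢
    -- As for noncommutative words, degree below 2 leaves no room for cofactors.
    simp only [map_add, Finsupp.degree_single] at hlt
    have hlen := congrArg Finsupp.degree hw
    simp only [map_add, Finsupp.degree_single] at hlen
    obtain rfl : a = 0 := (Finsupp.degree_eq_zero_iff _).1 (by omega)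
    obtain rfl : b = 0 := (Finsupp.degree_eq_zero_iff _).1 (by omega)
    rw [add_zero, add_zero] at hw
    obtain rfl := letter_injective (single_injective hw)
    rw [sub_self]
    exact zero_mem _

end Leading

end Com

end DiffGS

end

theorem mainTheorem8 {k : Type u} [Field k] [CharZero k] (lam : k) :
    -- the noncommutative setting
    ((∃ (dbar : DiffGS.NC.Quot k →ₗ[k] DiffGS.NC.Quot k)
        (iA : DiffGS.AlgA k →ₐ[k] DiffGS.NC.Quot k),
        (∀ f, dbar (DiffGS.NC.proj k f) = DiffGS.NC.proj k (DiffGS.NC.deriv lam f)) ∧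
        (∀ z, iA (DiffGS.AlgA.gen k z) =
          DiffGS.NC.proj k (DiffGS.NC.var k (DiffGS.letter z 0))) ∧
        DiffGS.IsFreeDiffAlgOn.{u, w} lam dbar iA) ∧
      DiffGS.NC.diffIdeal lam (DiffGS.NC.sHat k) = DiffGS.NC.relIdeal k ∧
      DiffGS.NC.IsGSBasis lam (DiffGS.NC.sHat k) ∧
      DiffGS.NC.DIrr lam (DiffGS.NC.sHat k) =
        (Submonoid.closure (Set.range fun m : ℕ =>
          FreeMonoid.of (DiffGS.letter DiffGS.genY m)) : Set (DiffGS.NC.Word DiffGS.XY)) ∧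
      ∃ b : Module.Basis (DiffGS.NC.DIrr lam (DiffGS.NC.sHat k)) k (DiffGS.NC.Quot k),
        ∀ p, b p = DiffGS.NC.proj k (DiffGS.NC.mono k p.1)) ∧
    -- the commutative setting
    ((∃ (dbar : DiffGS.Com.Quot k →ₗ[k] DiffGS.Com.Quot k)
        (iA : DiffGS.AlgA k →ₐ[k] DiffGS.Com.Quot k),
        (∀ f, dbar (DiffGS.Com.proj k f) = DiffGS.Com.proj k (DiffGS.Com.deriv lam f)) ∧
        (∀ z, iA (DiffGS.AlgA.gen k z) =
          DiffGS.Com.proj k (DiffGS.Com.var k (DiffGS.letter z 0))) ∧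
        DiffGS.IsFreeCommDiffAlgOn.{u, w} lam dbar iA) ∧
      DiffGS.Com.diffIdeal lam (DiffGS.Com.sHat k) = DiffGS.Com.relIdeal k ∧
      DiffGS.Com.IsGSBasis lam (DiffGS.Com.sHat k) ∧
      DiffGS.Com.DIrr lam (DiffGS.Com.sHat k) =
        (AddSubmonoid.closure (Set.range fun m : ℕ =>
          Finsupp.single (DiffGS.letter DiffGS.genY m) 1) : Set (DiffGS.Com.Word DiffGS.XY)) ∧
      ∃ b : Module.Basis (DiffGS.Com.DIrr lam (DiffGS.Com.sHat k)) k (DiffGS.Com.Quot k),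
        ∀ p, b p = DiffGS.Com.proj k (DiffGS.Com.mono k p.1)) := by
  refine ⟨⟨DiffGS.NC.free_quot lam, DiffGS.NC.diffIdeal_sHat lam, DiffGS.NC.isGSBasis_sHat lam,
    DiffGS.NC.DIrr_sHat lam, ?_⟩, DiffGS.Com.free_quot lam, DiffGS.Com.diffIdeal_sHat lam,
    DiffGS.Com.isGSBasis_sHat lam, DiffGS.Com.DIrr_sHat lam, ?_⟩
  · rw [DiffGS.NC.DIrr_sHat lam]
    exact DiffGS.NC.exists_basis_yWords
  · rw [DiffGS.Com.DIrr_sHat lam]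
    exact DiffGS.Com.exists_basis_yWords
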